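/- Let $G$ be a finite group with identity $e$, let $\mathbb R[G]$ be its real group algebra with the Euclidean topology (coordinatewise convergence), and let $$S=\Big\{x=\sum_{g\in G}x_g\,g\in\mathbb R[G] : \sum_{g\in G}x_g=1,\ x_g\ge 0 \text{ for all } g\in G\Big\}.$$ Let $p(t)=\sum_{k=0}^\infty a_k t^k$ be a power series with $a_k\ge 0$ for all $k\ge 0$ and $\sum_{k=0}^\infty a_k=1$. Then for every $x\in S$ the series $p(x)=a_0e+a_1x+a_2x^2+\cdots$ converges, $p$ maps $S$ into $S$, and $p:S\to S$ is ergodic on $S$: writing $p^{[1]}(x)=p(x)$ and $p^{[n+1]}(x)=p(p^{[n]}(x))$, for every $x\in S$ the sequence of Cesàro means $$\frac1n\sum_{i=1}^n p^{[i]}(x),\qquad n=1,2,3,\dots,$$ converges to a point of $S$. -/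

import Mathlib

noncomputable section

open Filter Topology

namespace GroupAlgebraSimplex

/-- The Euclidean topology of the real group algebra: the topology of the coordinate space `G → ℝ`,
transported along `x ↦ (x_g)_{g ∈ G}`. (It is used below only for finite `G`.) -/
instance groupAlgebraTopology {G : Type*} : TopologicalSpace (MonoidAlgebra ℝ G) :=
  TopologicalSpace.induced (fun (x : MonoidAlgebra ℝ G) (g : G) => x.coeff g) inferInstance

/-- The natural simplex `S` of `ℝ[G]`: the `x = ∑ x_g g` with `x_g ≥ 0` and `∑ x_g = 1`. -/
def simplex (G : Type*) [Fintype G] : Set (MonoidAlgebra ℝ G) :=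
  {x | (∑ g : G, x.coeff g = 1) ∧ ∀ g : G, 0 ≤ x.coeff g}

/-- The term `a_k x ^ k` of the series `p(x)`, where `p(t) = ∑ a_k t ^ k`. -/
def seriesTerm {G : Type*} [Group G] (p : PowerSeries ℝ) (x : MonoidAlgebra ℝ G) (k : ℕ) :
    MonoidAlgebra ℝ G :=
  PowerSeries.coeff k p • x ^ k

/-- The power series map `x ↦ p(x) = a_0 e + a_1 x + a_2 x ^ 2 + ...` on `ℝ[G]`. -/
def seriesMap {G : Type*} [Group G] (p : PowerSeries ℝ) (x : MonoidAlgebra ℝ G) :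
    MonoidAlgebra ℝ G :=
  ∑' k : ℕ, seriesTerm p x k

/-- The Cesàro mean `(1/n) ∑_{i=1}^n f^[i](x)` of the orbit of `x` under `f`. -/
def cesaroMean {V : Type*} [AddCommMonoid V] [Module ℝ V] (f : V → V) (n : ℕ) (x : V) : V :=
  (1 / (n : ℝ)) • ∑ i ∈ Finset.Icc 1 n, f^[i] x

/-- `f` is ergodic on `S`: for every `x ∈ S` the Cesàro means of the orbit of `x` converge to a
point of `S`. -/
def ErgodicOn {V : Type*} [AddCommMonoid V] [Module ℝ V] [TopologicalSpace V]
    (f : V → V) (S : Set V) : Prop :=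
  ∀ x ∈ S, ∃ y ∈ S, Tendsto (fun n : ℕ => cesaroMean f n x) atTop (𝓝 y)

end GroupAlgebraSimplex

end

open Filter Topology

namespace GroupAlgebraSimplex

/-! Write `b i` for the coefficient sequence of the `i`-fold composition of `p` with itself, again a
probability distribution on `ℕ`. The `i`-th iterate at `x` is `∑ k, b i k • x ^ k`, so two facts are
needed: how the powers of `x` behave, and how the weights `b i` behave.

Powers: some `g` has positive weight in `x`, and `g ^ |G| = 1`, so `x ^ |G|` charges the identity.
This aperiodicity makes its powers converge (`exists_tendsto_pow_of_coeff_one_pos`). Each coordinate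
of `x ^ k` is thus an `|G|`-periodic sequence in `k` plus a null sequence.

Weights: unless `p = X`, the weights `b i k` tend to `0` for `k ≥ 1` and to some `q` for `k = 0`
(`exists_tendsto_coeff_seriesIter`). Hence the null part contributes a convergent sequence
(`tendsto_tsum_coeff_smul`). Fourier inversion writes the periodic part as a combination of `z ^ k`
with `z ^ |G| = 1`, which contributes the scalar orbits of `p` at roots of unity. Such an orbit
either stays on the unit circle, where it runs through finitely many roots of unity and is
eventually periodic, or enters the open disc and converges
(`cesaroConvergent_iterate_of_pow_eq_one`). In both cases its Cesàro means converge. The case `p =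
X` is the identity map. -/

/-- A power series with nonnegative coefficients of total mass one. -/
structure IsPGF (p : PowerSeries ℝ) : Prop where
  nonneg : ∀ k, 0 ≤ PowerSeries.coeff k p
  hasSum : HasSum (fun k => PowerSeries.coeff k p) 1

/-- The value `∑ a_k x ^ k` of a real power series at a point of a topological algebra. -/
noncomputable def evalSeries {A : Type*} [Ring A] [Module ℝ A] [TopologicalSpace A]
    (p : PowerSeries ℝ) (x : A) : A :=
  ∑' k : ℕ, PowerSeries.coeff k p • x ^ k

/-- The composition `p ∘ q`, with coefficients `∑ k, a_k * coeff j (q ^ k)`. -/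
noncomputable def seriesComp (p q : PowerSeries ℝ) : PowerSeries ℝ :=
  PowerSeries.mk fun j => ∑' k : ℕ, PowerSeries.coeff k p * PowerSeries.coeff j (q ^ k)

/-- The `i`-fold composition of `p` with itself. -/
noncomputable def seriesIter (p : PowerSeries ℝ) : ℕ → PowerSeries ℝ
  | 0 => PowerSeries.X
  | i + 1 => seriesComp p (seriesIter p i)

/-! ### Generating functions on the unit ball of a Banach algebra: products and composition. -/

theorem norm_pow_le_one_of_norm_le_one {A : Type*} [NormedRing A] [NormOneClass A]
    {x : A} (hx : ‖x‖ ≤ 1) (k : ℕ) : ‖x ^ k‖ ≤ 1 :=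
  (norm_pow_le x k).trans (pow_le_one₀ (norm_nonneg x) hx)

section NormedAlgebra

variable {A : Type*} [NormedRing A] [NormedAlgebra ℝ A] [NormOneClass A]

namespace IsPGF

variable {p q : PowerSeries ℝ}

theorem norm_term_le (hp : IsPGF p) {x : A} (hx : ‖x‖ ≤ 1) (k : ℕ) :
    ‖PowerSeries.coeff k p • x ^ k‖ ≤ PowerSeries.coeff k p := by
  rw [norm_smul, Real.norm_of_nonneg (hp.nonneg k)]
  exact mul_le_of_le_one_right (hp.nonneg k) (norm_pow_le_one_of_norm_le_one hx k)

theorem summable_norm (hp : IsPGF p) {x : A} (hx : ‖x‖ ≤ 1) :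
    Summable fun k => ‖PowerSeries.coeff k p • x ^ k‖ :=
  Summable.of_nonneg_of_le (fun _ => norm_nonneg _) (hp.norm_term_le hx) hp.hasSum.summable

theorem norm_evalSeries_le (hp : IsPGF p) {x : A} (hx : ‖x‖ ≤ 1) : ‖evalSeries p x‖ ≤ 1 :=
  tsum_of_norm_bounded hp.hasSum (hp.norm_term_le hx)

variable [CompleteSpace A]

theorem hasSum_evalSeries (hp : IsPGF p) {x : A} (hx : ‖x‖ ≤ 1) :
    HasSum (fun k => PowerSeries.coeff k p • x ^ k) (evalSeries p x) :=
  (hp.summable_norm hx).of_norm.hasSum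

theorem hasSum_evalSeries_mul (hp : IsPGF p) (hq : IsPGF q) {x : A} (hx : ‖x‖ ≤ 1) :
    HasSum (fun k => PowerSeries.coeff k (p * q) • x ^ k) (evalSeries p x * evalSeries q x) := by
  have h := tsum_mul_tsum_eq_tsum_sum_antidiagonal_of_summable_norm
    (hp.summable_norm hx) (hq.summable_norm hx)
  have hs := (summable_norm_sum_mul_antidiagonal_of_summable_norm
    (hp.summable_norm hx) (hq.summable_norm hx)).of_norm
  have e : (fun k => PowerSeries.coeff k (p * q) • x ^ k) = fun n =>
      ∑ kl ∈ Finset.HasAntidiagonal.antidiagonal n,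
        PowerSeries.coeff kl.1 p • x ^ kl.1 * PowerSeries.coeff kl.2 q • x ^ kl.2 := by
    funext n
    rw [PowerSeries.coeff_mul, Finset.sum_smul]
    refine Finset.sum_congr rfl fun kl hkl => ?_
    rw [smul_mul_smul_comm, ← pow_add, Finset.HasAntidiagonal.mem_antidiagonal.1 hkl]
  rw [evalSeries, evalSeries, h, e]
  exact hs.hasSum

end IsPGF

end NormedAlgebra

namespace IsPGF

variable {p q : PowerSeries ℝ}

theorem evalSeries_one (hp : IsPGF p) : evalSeries p (1 : ℝ) = 1 := by
  simpa [evalSeries] using hp.hasSum.tsum_eq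

theorem one : IsPGF 1 where
  nonneg k := by rw [PowerSeries.coeff_one]; split_ifs <;> norm_num
  hasSum := by
    simp only [PowerSeries.coeff_one]
    exact hasSum_ite_eq 0 1

theorem X : IsPGF PowerSeries.X where
  nonneg k := by rw [PowerSeries.coeff_X]; split_ifs <;> norm_num
  hasSum := by
    simp only [PowerSeries.coeff_X]
    exact hasSum_ite_eq 1 1

theorem mul (hp : IsPGF p) (hq : IsPGF q) : IsPGF (p * q) where
  nonneg k := by
    rw [PowerSeries.coeff_mul]
    exact Finset.sum_nonneg fun kl _ => mul_nonneg (hp.nonneg _) (hq.nonneg _)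
  hasSum := by
    simpa [hp.evalSeries_one, hq.evalSeries_one] using
      hp.hasSum_evalSeries_mul hq (x := (1 : ℝ)) (by simp)

theorem pow (hp : IsPGF p) (k : ℕ) : IsPGF (p ^ k) := by
  induction k with
  | zero => simpa using one
  | succ k ih => rw [pow_succ]; exact ih.mul hp

/-- Absolute summability of the double series. Since `q` may have a nonzero constant term, the
coefficients of the composition are genuine infinite sums, and this licenses every interchange. -/
theorem summable_prod_comp (hp : IsPGF p) (hq : IsPGF q) :
    Summable fun z : ℕ × ℕ => PowerSeries.coeff z.1 p * PowerSeries.coeff z.2 (q ^ z.1) := by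
  refine (summable_prod_of_nonneg fun z => ?_).2 ⟨fun k => ?_, ?_⟩
  · exact mul_nonneg (hp.nonneg _) ((hq.pow _).nonneg _)
  · exact (hq.pow k).hasSum.summable.mul_left (PowerSeries.coeff k p)
  · simpa [tsum_mul_left, (hq.pow _).hasSum.tsum_eq] using hp.hasSum.summable

section NormedAlgebra

variable {A : Type*} [NormedRing A] [NormedAlgebra ℝ A] [NormOneClass A] [CompleteSpace A]

theorem evalSeries_pow (hp : IsPGF p) {x : A} (hx : ‖x‖ ≤ 1) (k : ℕ) :
    evalSeries (p ^ k) x = evalSeries p x ^ k := by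
  induction k with
  | zero =>
    rw [pow_zero, pow_zero, evalSeries, tsum_eq_single 0]
    · simp
    · intro k hk
      simp [PowerSeries.coeff_one, hk]
  | succ k ih =>
    rw [pow_succ, pow_succ, ← ih]
    exact ((hp.pow k).hasSum_evalSeries_mul hp hx).tsum_eq

theorem evalSeries_seriesComp (hp : IsPGF p) (hq : IsPGF q) {x : A} (hx : ‖x‖ ≤ 1) :
    evalSeries (seriesComp p q) x = evalSeries p (evalSeries q x) := by
  have hs : Summable fun z : ℕ × ℕ =>
      (PowerSeries.coeff z.1 p * PowerSeries.coeff z.2 (q ^ z.1)) • x ^ z.2 := by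
    refine Summable.of_norm_bounded (hp.summable_prod_comp hq) fun z => ?_
    have h0 := mul_nonneg (hp.nonneg z.1) ((hq.pow z.1).nonneg z.2)
    rw [norm_smul, Real.norm_of_nonneg h0]
    exact mul_le_of_le_one_right h0 (norm_pow_le_one_of_norm_le_one hx _)
  have hswap := hs.tsum_comm' (fun k => hs.prod_factor k) (fun j => hs.prod_symm.prod_factor j)
  have hj (j : ℕ) : Summable fun k =>
      PowerSeries.coeff k p * PowerSeries.coeff j (q ^ k) :=
    (hp.summable_prod_comp hq).prod_symm.prod_factor j
  calc evalSeries (seriesComp p q) x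
      = ∑' j, ∑' k, (PowerSeries.coeff k p * PowerSeries.coeff j (q ^ k)) • x ^ j := by
        refine tsum_congr fun j => ?_
        rw [seriesComp, PowerSeries.coeff_mk, (hj j).tsum_smul_const]
    _ = ∑' k, ∑' j, (PowerSeries.coeff k p * PowerSeries.coeff j (q ^ k)) • x ^ j := hswap
    _ = evalSeries p (evalSeries q x) := by
        refine tsum_congr fun k => ?_
        rw [← hq.evalSeries_pow hx, evalSeries,
          ← ((hq.pow k).hasSum_evalSeries hx).summable.tsum_const_smul]
        exact tsum_congr fun j => mul_smul _ _ _

end NormedAlgebra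

theorem seriesComp (hp : IsPGF p) (hq : IsPGF q) : IsPGF (seriesComp p q) where
  nonneg j := by
    rw [GroupAlgebraSimplex.seriesComp, PowerSeries.coeff_mk]
    exact tsum_nonneg fun k => mul_nonneg (hp.nonneg _) ((hq.pow _).nonneg _)
  hasSum := by
    have hs : Summable fun j => PowerSeries.coeff j (GroupAlgebraSimplex.seriesComp p q) := by
      simpa [GroupAlgebraSimplex.seriesComp] using (hp.summable_prod_comp hq).prod_symm.prod
    have h := hp.evalSeries_seriesComp hq (x := (1 : ℝ)) (by simp)
    rw [hq.evalSeries_one, hp.evalSeries_one] at h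
    rw [← h]
    simpa [evalSeries] using hs.hasSum

theorem seriesIter (hp : IsPGF p) (i : ℕ) : IsPGF (seriesIter p i) := by
  induction i with
  | zero => exact X
  | succ i ih => exact hp.seriesComp ih

theorem evalSeries_seriesIter (hp : IsPGF p) {A : Type*} [NormedRing A] [NormedAlgebra ℝ A]
    [NormOneClass A] [CompleteSpace A] {x : A} (hx : ‖x‖ ≤ 1) (i : ℕ) :
    evalSeries (GroupAlgebraSimplex.seriesIter p i) x = (evalSeries p)^[i] x := by
  induction i with
  | zero =>
    rw [GroupAlgebraSimplex.seriesIter, evalSeries, tsum_eq_single 1]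
    · simp
    · intro k hk
      simp [PowerSeries.coeff_X, hk]
  | succ i ih =>
    rw [GroupAlgebraSimplex.seriesIter, hp.evalSeries_seriesComp (hp.seriesIter i) hx, ih,
      Function.iterate_succ_apply']

end IsPGF

/-! ### Iteration on the interval `[0, 1]` and the limit of the weights. -/

namespace IsPGF

variable {p : PowerSeries ℝ}

theorem hasSum_evalSeries_real (hp : IsPGF p) {t : ℝ} (ht : t ∈ Set.Icc (0 : ℝ) 1) :
    HasSum (fun k => PowerSeries.coeff k p * t ^ k) (evalSeries p t) :=
  hp.hasSum_evalSeries (by rw [Real.norm_of_nonneg ht.1]; exact ht.2)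

theorem mapsTo_Icc (hp : IsPGF p) :
    Set.MapsTo (evalSeries p) (Set.Icc (0 : ℝ) 1) (Set.Icc (0 : ℝ) 1) := fun t ht => by
  refine ⟨(hp.hasSum_evalSeries_real ht).nonneg fun k => ?_, ?_⟩
  · exact mul_nonneg (hp.nonneg k) (pow_nonneg ht.1 k)
  · exact hasSum_le (fun k => mul_le_of_le_one_right (hp.nonneg k) (pow_le_one₀ ht.1 ht.2))
      (hp.hasSum_evalSeries_real ht) hp.hasSum

theorem monotoneOn_evalSeries (hp : IsPGF p) :
    MonotoneOn (evalSeries p) (Set.Icc (0 : ℝ) 1) := fun _ hs _ ht hst =>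
  hasSum_le (fun k => mul_le_mul_of_nonneg_left (pow_le_pow_left₀ hs.1 hst k) (hp.nonneg k))
    (hp.hasSum_evalSeries_real hs) (hp.hasSum_evalSeries_real ht)

theorem continuousOn_evalSeries (hp : IsPGF p) :
    ContinuousOn (evalSeries p) (Set.Icc (0 : ℝ) 1) := by
  refine continuousOn_tsum (fun k => by fun_prop) hp.hasSum.summable fun k t ht => ?_
  exact hp.norm_term_le (by rw [Real.norm_of_nonneg ht.1]; exact ht.2) k

theorem iterate_mem_Icc (hp : IsPGF p) {t : ℝ} (ht : t ∈ Set.Icc (0 : ℝ) 1) (i : ℕ) :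
    (evalSeries p)^[i] t ∈ Set.Icc (0 : ℝ) 1 :=
  hp.mapsTo_Icc.iterate i ht

theorem monotoneOn_iterate (hp : IsPGF p) (i : ℕ) :
    MonotoneOn (evalSeries p)^[i] (Set.Icc (0 : ℝ) 1) := fun s hs t ht hst => by
  induction i with
  | zero => exact hst
  | succ i ih =>
    rw [Function.iterate_succ_apply', Function.iterate_succ_apply']
    exact hp.monotoneOn_evalSeries (hp.iterate_mem_Icc hs i) (hp.iterate_mem_Icc ht i) ih

theorem fixed_of_tendsto_iterate (hp : IsPGF p) {t c : ℝ} (ht : t ∈ Set.Icc (0 : ℝ) 1)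
    (h : Tendsto (fun i => (evalSeries p)^[i] t) atTop (𝓝 c)) :
    c ∈ Set.Icc (0 : ℝ) 1 ∧ evalSeries p c = c := by
  have hc : c ∈ Set.Icc (0 : ℝ) 1 :=
    isClosed_Icc.mem_of_tendsto h (Eventually.of_forall (hp.iterate_mem_Icc ht))
  refine ⟨hc, tendsto_nhds_unique (f := fun i => (evalSeries p)^[i + 1] t) ?_
    ((tendsto_add_atTop_iff_nat 1).2 h)⟩
  simp only [Function.iterate_succ_apply']
  exact (hp.continuousOn_evalSeries c hc).tendsto.comp
    (tendsto_nhdsWithin_iff.2 ⟨h, Eventually.of_forall (hp.iterate_mem_Icc ht)⟩)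

theorem exists_tendsto_iterate_zero (hp : IsPGF p) :
    ∃ q, Tendsto (fun i => (evalSeries p)^[i] (0 : ℝ)) atTop (𝓝 q) := by
  have h0 : (0 : ℝ) ∈ Set.Icc (0 : ℝ) 1 := by simp
  refine ⟨_, tendsto_atTop_ciSup (monotone_nat_of_le_succ fun i => ?_) ⟨1, ?_⟩⟩
  · rw [Function.iterate_succ_apply]
    exact hp.monotoneOn_iterate i h0 (hp.mapsTo_Icc h0) (hp.mapsTo_Icc h0).1
  · rintro _ ⟨i, rfl⟩
    exact (hp.iterate_mem_Icc h0 i).2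

/-- Convexity of `t ^ k` on the chord from `s` to `1`, cleared of denominators so that it can be
summed against the coefficients. -/
theorem pow_chord_le {s t : ℝ} (hs : 0 ≤ s) (hst : s ≤ t) (ht : t ≤ 1) (k : ℕ) :
    (1 - s) * t ^ k ≤ (1 - t) * s ^ k + (t - s) := by
  rcases (hst.trans ht).eq_or_lt with rfl | h1
  · obtain rfl : t = 1 := le_antisymm ht hst
    simp
  have ha : 0 ≤ (1 - t) / (1 - s) := div_nonneg (by linarith) (by linarith)
  have hb : 0 ≤ (t - s) / (1 - s) := div_nonneg (by linarith) (by linarith)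
  have h := (convexOn_pow k).2 (Set.mem_Ici.2 hs) (Set.mem_Ici.2 zero_le_one) ha hb
    (by rw [← add_div, div_eq_one_iff_eq (by linarith)]; ring)
  have e : (1 - t) / (1 - s) * s + (t - s) / (1 - s) = t := by
    have : 1 - s ≠ 0 := by linarith
    field_simp
    ring
  simp only [smul_eq_mul, mul_one, one_pow, e] at h
  have h2 := mul_le_mul_of_nonneg_left h (by linarith : 0 ≤ 1 - s)
  have : 1 - s ≠ 0 := by linarith
  calc _ ≤ _ := h2
    _ = _ := by field_simp

theorem pow_chord_lt {s t : ℝ} (hs : 0 ≤ s) (hst : s < t) (ht : t < 1) {k : ℕ} (hk : 2 ≤ k) :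
    (1 - s) * t ^ k < (1 - t) * s ^ k + (t - s) := by
  have h1 : s < 1 := hst.trans ht
  have ha : 0 < (1 - t) / (1 - s) := div_pos (by linarith) (by linarith)
  have hb : 0 < (t - s) / (1 - s) := div_pos (by linarith) (by linarith)
  have h := (strictConvexOn_pow hk).2 (Set.mem_Ici.2 hs) (Set.mem_Ici.2 zero_le_one) h1.ne ha hb
    (by rw [← add_div, div_eq_one_iff_eq (by linarith)]; ring)
  have e : (1 - t) / (1 - s) * s + (t - s) / (1 - s) = t := by
    have : 1 - s ≠ 0 := by linarith
    field_simp
    ring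
  simp only [smul_eq_mul, mul_one, one_pow, e] at h
  have h2 := mul_lt_mul_of_pos_left h (by linarith : 0 < 1 - s)
  have : 1 - s ≠ 0 := by linarith
  calc _ < _ := h2
    _ = _ := by field_simp

theorem hasSum_chord (hp : IsPGF p) {s t : ℝ} (hs : s ∈ Set.Icc (0 : ℝ) 1) :
    HasSum (fun k => PowerSeries.coeff k p * ((1 - t) * s ^ k + (t - s)))
      ((1 - t) * evalSeries p s + (t - s)) := by
  have h := ((hp.hasSum_evalSeries_real hs).mul_left (1 - t)).add (hp.hasSum.mul_left (t - s))
  rw [mul_one] at h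
  exact h.congr_fun fun k => by ring

theorem evalSeries_le_of_fixed_le (hp : IsPGF p) {s t : ℝ} (hs : 0 ≤ s) (hs1 : s < 1)
    (hfix : evalSeries p s = s) (hst : s ≤ t) (ht : t ≤ 1) : evalSeries p t ≤ t := by
  have h := hasSum_le
    (fun k => mul_le_mul_of_nonneg_left (pow_chord_le hs hst ht k) (hp.nonneg k))
    (((hp.hasSum_evalSeries_real ⟨hs.trans hst, ht⟩).mul_left (1 - s)).congr_fun fun k => by ring)
    (hp.hasSum_chord ⟨hs, hs1.le⟩)
  rw [hfix] at h
  nlinarith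

/-- With `1`, these are three fixed points of a convex function. A positive coefficient of degree at
least two would make the chord inequality from `s` to `1` strict at `t`, so `p` is affine, and then
it is the identity. -/
theorem eq_X_of_two_fixed (hp : IsPGF p) {s t : ℝ} (hs : 0 ≤ s) (hst : s < t) (ht : t < 1)
    (hfs : evalSeries p s = s) (hft : evalSeries p t = t) : p = PowerSeries.X := by
  have hs1 : s < 1 := hst.trans ht
  have hk2 : ∀ k, 2 ≤ k → PowerSeries.coeff k p = 0 := by
    intro k hk
    by_contra hne
    have hpos := lt_of_le_of_ne (hp.nonneg k) (Ne.symm hne)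
    have h := hasSum_lt
      (fun k => mul_le_mul_of_nonneg_left (pow_chord_le hs hst.le ht.le k) (hp.nonneg k))
      (mul_lt_mul_of_pos_left (pow_chord_lt hs hst ht hk) hpos)
      (((hp.hasSum_evalSeries_real ⟨hs.trans hst.le, ht.le⟩).mul_left (1 - s)).congr_fun
        fun k => by ring)
      (hp.hasSum_chord ⟨hs, hs1.le⟩)
    rw [hfs, hft] at h
    nlinarith
  have hz : ∀ k ∉ Finset.range 2, PowerSeries.coeff k p = 0 := fun k hk =>
    hk2 k (not_lt.1 fun h => hk (Finset.mem_range.2 h))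
  have e1 := (hasSum_sum_of_ne_finset_zero hz).unique hp.hasSum
  have e2 := (hasSum_sum_of_ne_finset_zero (f := fun k => PowerSeries.coeff k p * s ^ k)
    (s := Finset.range 2) fun k hk => by rw [hz k hk, zero_mul]).unique
    (hp.hasSum_evalSeries_real ⟨hs, hs1.le⟩)
  rw [hfs] at e2
  simp only [Finset.sum_range_succ, Finset.sum_range_zero, pow_zero, pow_one, mul_one,
    zero_add] at e1 e2
  have h0 : PowerSeries.coeff 0 p = 0 := by
    have : PowerSeries.coeff 0 p * (1 - s) = 0 := by linear_combination e2 - s * e1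
    exact (mul_eq_zero.1 this).resolve_right (by linarith)
  ext k
  rw [PowerSeries.coeff_X]
  rcases k with _ | _ | k
  · simpa using h0
  · simpa [h0] using e1
  · simpa using hk2 (k + 2) (by omega)

/-- A positive point `r` with the same orbit limit as `0` is what controls the higher coefficients
of the iterates. -/
theorem exists_tendsto_iterate_pos (hp : IsPGF p) (hX : p ≠ PowerSeries.X) {q : ℝ}
    (hq : Tendsto (fun i => (evalSeries p)^[i] (0 : ℝ)) atTop (𝓝 q)) :
    ∃ r : ℝ, 0 < r ∧ r ≤ 1 ∧ Tendsto (fun i => (evalSeries p)^[i] r) atTop (𝓝 q) := by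
  have h0 : (0 : ℝ) ∈ Set.Icc (0 : ℝ) 1 := by simp
  obtain ⟨hqI, hfix⟩ := hp.fixed_of_tendsto_iterate h0 hq
  rcases hqI.2.eq_or_lt with rfl | hq1
  · have hr : (1 / 2 : ℝ) ∈ Set.Icc (0 : ℝ) 1 := by norm_num
    refine ⟨1 / 2, by norm_num, by norm_num, tendsto_of_tendsto_of_tendsto_of_le_of_le hq
      tendsto_const_nhds (fun i => ?_) fun i => (hp.iterate_mem_Icc hr i).2⟩
    exact hp.monotoneOn_iterate i h0 hr (by norm_num)
  -- The orbit of `r` decreases to a fixed point in `[q, r]`, and `r < 1` leaves no fixed point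
  -- there except `q`.
  · set r : ℝ := max q (1 / 2) with hrdef
    have hr1 : r < 1 := max_lt hq1 (by norm_num)
    have hqr : q ≤ r := le_max_left _ _
    have hr : r ∈ Set.Icc (0 : ℝ) 1 := ⟨hqI.1.trans hqr, hr1.le⟩
    have hanti : Antitone fun i => (evalSeries p)^[i] r := antitone_nat_of_succ_le fun i => by
      rw [Function.iterate_succ_apply]
      exact hp.monotoneOn_iterate i (hp.mapsTo_Icc hr) hr
        (hp.evalSeries_le_of_fixed_le hqI.1 hq1 hfix hqr hr1.le)
    have hbdd : BddBelow (Set.range fun i => (evalSeries p)^[i] r) :=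
      ⟨0, by rintro _ ⟨i, rfl⟩; exact (hp.iterate_mem_Icc hr i).1⟩
    have hlim := tendsto_atTop_ciInf hanti hbdd
    set m := ⨅ i, (evalSeries p)^[i] r
    obtain ⟨-, hmfix⟩ := hp.fixed_of_tendsto_iterate hr hlim
    have hqm : q ≤ m := le_of_tendsto_of_tendsto' hq hlim fun i =>
      hp.monotoneOn_iterate i h0 hr hr.1
    have hmr : m ≤ r := ciInf_le hbdd 0
    refine ⟨r, lt_of_lt_of_le (by norm_num) (le_max_right _ _), hr1.le, ?_⟩
    rcases hqm.eq_or_lt with h | h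
    · rwa [h]
    · exact absurd (hp.eq_X_of_two_fixed hqI.1 h (hmr.trans_lt hr1) hfix hmfix) hX

theorem exists_tendsto_coeff_seriesIter (hp : IsPGF p) (hX : p ≠ PowerSeries.X) :
    ∃ q : ℝ, ∀ k, Tendsto (fun i => PowerSeries.coeff k (GroupAlgebraSimplex.seriesIter p i)) atTop
      (𝓝 (if k = 0 then q else 0)) := by
  obtain ⟨q, hq⟩ := hp.exists_tendsto_iterate_zero
  obtain ⟨r, hr0, hr1, hr⟩ := hp.exists_tendsto_iterate_pos hX hq
  have hrI : r ∈ Set.Icc (0 : ℝ) 1 := ⟨hr0.le, hr1⟩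
  have hzero (i : ℕ) : PowerSeries.coeff 0 (GroupAlgebraSimplex.seriesIter p i) =
      (evalSeries p)^[i] (0 : ℝ) := by
    rw [← hp.evalSeries_seriesIter (by simp) i, evalSeries, tsum_eq_single 0]
    · simp
    · intro k hk
      simp [hk]
  refine ⟨q, fun k => ?_⟩
  split_ifs with hk
  · subst hk
    simpa only [hzero] using hq
  -- The terms of degree `0` and `k` alone are at most the value at `r`, and the term of degree `0`
  -- is the value at `0`.
  · have hle (i : ℕ) : PowerSeries.coeff k (GroupAlgebraSimplex.seriesIter p i) ≤
        ((evalSeries p)^[i] r - (evalSeries p)^[i] 0) / r ^ k := by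
      rw [le_div_iff₀ (pow_pos hr0 k), ← hzero,
        ← hp.evalSeries_seriesIter (by rw [Real.norm_of_nonneg hr0.le]; exact hr1) i]
      have h := sum_le_hasSum {0, k} (fun j _ => mul_nonneg ((hp.seriesIter i).nonneg j)
        (pow_nonneg hr0.le j)) ((hp.seriesIter i).hasSum_evalSeries_real hrI)
      rw [Finset.sum_pair (Ne.symm hk), pow_zero, mul_one] at h
      linarith
    refine tendsto_of_tendsto_of_tendsto_of_le_of_le tendsto_const_nhds ?_
      (fun i => (hp.seriesIter i).nonneg k) hle
    simpa using (hr.sub hq).div_const (r ^ k)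

end IsPGF

/-! ### Toeplitz averaging. -/

theorem IsPGF.summable_smul_of_tendsto {p : PowerSeries ℝ} (hp : IsPGF p) {E : Type*}
    [NormedAddCommGroup E] [NormedSpace ℝ E] [CompleteSpace E] {f : ℕ → E} {y : E}
    (hf : Tendsto f atTop (𝓝 y)) : Summable fun k => PowerSeries.coeff k p • f k := by
  obtain ⟨C, hC⟩ := hf.norm.bddAbove_range
  refine Summable.of_norm_bounded (hp.hasSum.summable.mul_right C) fun k => ?_
  rw [norm_smul, Real.norm_of_nonneg (hp.nonneg k)]
  exact mul_le_mul_of_nonneg_left (hC ⟨k, rfl⟩) (hp.nonneg k)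

/-- Toeplitz averaging of a null sequence along generating functions whose coefficients converge to
those of a constant. -/
theorem tendsto_tsum_coeff_smul {E : Type*} [NormedAddCommGroup E] [NormedSpace ℝ E]
    [CompleteSpace E] {b : ℕ → PowerSeries ℝ} (hb : ∀ i, IsPGF (b i)) {q : ℝ}
    (hq : ∀ k, Tendsto (fun i => PowerSeries.coeff k (b i)) atTop (𝓝 (if k = 0 then q else 0)))
    {f : ℕ → E} (hf : Tendsto f atTop (𝓝 0)) :
    Tendsto (fun i => ∑' k, PowerSeries.coeff k (b i) • f k) atTop (𝓝 (q • f 0)) := by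
  have hsum (i : ℕ) := (hb i).summable_smul_of_tendsto hf
  rw [Metric.tendsto_atTop]
  intro ε hε
  obtain ⟨K, hK⟩ := Metric.tendsto_atTop.1 hf (ε / 2) (half_pos hε)
  have hfin : Tendsto (fun i => ∑ k ∈ Finset.range (K + 1), PowerSeries.coeff k (b i) • f k) atTop
      (𝓝 (q • f 0)) := by
    have h := tendsto_finsetSum (Finset.range (K + 1)) fun k _ => (hq k).smul_const (f k)
    simpa [ite_smul] using h
  obtain ⟨I, hI⟩ := Metric.tendsto_atTop.1 hfin (ε / 2) (half_pos hε)
  refine ⟨I, fun i hi => ?_⟩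
  -- The weights have total mass one, so the tail bound is uniform in `i`.
  have htail : ‖∑' k, PowerSeries.coeff (k + (K + 1)) (b i) • f (k + (K + 1))‖ ≤ ε / 2 := by
    have hs : Summable fun k => PowerSeries.coeff (k + (K + 1)) (b i) :=
      (summable_nat_add_iff (K + 1)).2 (hb i).hasSum.summable
    have hle : ∑' k, PowerSeries.coeff (k + (K + 1)) (b i) ≤ 1 := by
      rw [← (hb i).hasSum.tsum_eq, ← (hb i).hasSum.summable.sum_add_tsum_nat_add (K + 1)]
      exact le_add_of_nonneg_left (Finset.sum_nonneg fun k _ => (hb i).nonneg k)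
    refine (tsum_of_norm_bounded (hs.hasSum.mul_right (ε / 2)) fun k => ?_).trans
      (mul_le_of_le_one_left (half_pos hε).le hle)
    rw [norm_smul, Real.norm_of_nonneg ((hb i).nonneg _)]
    refine mul_le_mul_of_nonneg_left ?_ ((hb i).nonneg _)
    simpa using (hK (k + (K + 1)) (by omega)).le
  have hd := hI i hi
  rw [dist_eq_norm] at hd ⊢
  rw [← (hsum i).sum_add_tsum_nat_add (K + 1), add_sub_right_comm]
  linarith [norm_add_le ((∑ k ∈ Finset.range (K + 1), PowerSeries.coeff k (b i) • f k) - q • f 0)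
    (∑' k, PowerSeries.coeff (k + (K + 1)) (b i) • f (k + (K + 1)))]

/-! ### Cesàro convergence of sequences. -/

section Cesaro

variable {E : Type*} [NormedAddCommGroup E] [NormedSpace ℝ E]

/-- The averages `(s 0 + ⋯ + s (n - 1)) / n` converge. -/
def CesaroConvergent (s : ℕ → E) : Prop :=
  ∃ y, Tendsto (fun n : ℕ => (n : ℝ)⁻¹ • ∑ i ∈ Finset.range n, s i) atTop (𝓝 y)

namespace CesaroConvergent

theorem of_tendsto {s : ℕ → E} {y : E} (h : Tendsto s atTop (𝓝 y)) : CesaroConvergent s :=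
  ⟨y, h.cesaro_smul⟩

theorem add {s t : ℕ → E} (hs : CesaroConvergent s) (ht : CesaroConvergent t) :
    CesaroConvergent fun i => s i + t i := by
  obtain ⟨y, hy⟩ := hs
  obtain ⟨z, hz⟩ := ht
  refine ⟨y + z, (hy.add hz).congr fun n => ?_⟩
  rw [Finset.sum_add_distrib, smul_add]

theorem const_mul {s : ℕ → ℂ} (c : ℂ) (hs : CesaroConvergent s) :
    CesaroConvergent fun i => c * s i := by
  obtain ⟨y, hy⟩ := hs
  refine ⟨c * y, (hy.const_mul c).congr fun n => ?_⟩
  rw [← Finset.mul_sum, mul_smul_comm]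

theorem finset_sum {ι : Type*} (I : Finset ι) {s : ι → ℕ → E}
    (hs : ∀ j ∈ I, CesaroConvergent (s j)) : CesaroConvergent fun i => ∑ j ∈ I, s j i := by
  classical
  induction I using Finset.induction_on with
  | empty => exact of_tendsto (y := 0) (by simp)
  | insert a I ha ih =>
    simp only [Finset.sum_insert ha]
    exact (hs a (Finset.mem_insert_self a I)).add
      (ih fun j hj => hs j (Finset.mem_insert_of_mem hj))

theorem of_shift_one {s : ℕ → E} (h : CesaroConvergent fun i => s (i + 1)) :
    CesaroConvergent s := by
  obtain ⟨y, hy⟩ := h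
  refine ⟨(1 : ℝ) • y + (0 : ℝ) • s 0, (tendsto_add_atTop_iff_nat 1).1 ?_⟩
  refine (((tendsto_natCast_div_add_atTop (1 : ℝ)).smul hy).add
    (tendsto_one_div_add_atTop_nhds_zero_nat.smul_const (s 0))).congr fun n => ?_
  rw [Finset.sum_range_succ', smul_add, smul_smul]
  -- At `n = 0` the factor `0 / 1 * 0⁻¹` is not `1⁻¹`, but there the sum is empty.
  rcases n with _ | n
  · simp
  · congr 2
    · push_cast
      field_simp
    · push_cast
      field_simp

theorem shift_one {s : ℕ → E} (h : CesaroConvergent s) :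
    CesaroConvergent fun i => s (i + 1) := by
  obtain ⟨y, hy⟩ := h
  have h1 : Tendsto (fun n : ℕ => ((n : ℝ) / (n + 1))⁻¹) atTop (𝓝 1) := by
    simpa using (tendsto_natCast_div_add_atTop (1 : ℝ)).inv₀ one_ne_zero
  refine ⟨(1 : ℝ) • y - (0 : ℝ) • s 0, ?_⟩
  refine ((h1.smul ((tendsto_add_atTop_iff_nat 1).2 hy)).sub
    ((tendsto_inv_atTop_nhds_zero_nat (𝕜 := ℝ)).smul_const (s 0))).congr fun n => ?_
  rw [Finset.sum_range_succ', smul_add, smul_add, smul_smul, smul_smul]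
  have e : ((n : ℝ) / (n + 1))⁻¹ * ((n + 1 : ℕ) : ℝ)⁻¹ = (n : ℝ)⁻¹ := by
    push_cast
    have : (n : ℝ) + 1 ≠ 0 := by positivity
    rw [inv_div]
    field_simp
  rw [e, add_sub_cancel_right]

theorem of_shift {s : ℕ → E} (m : ℕ) (h : CesaroConvergent fun i => s (i + m)) :
    CesaroConvergent s := by
  induction m with
  | zero => exact h
  | succ m ih =>
    refine ih (of_shift_one ?_)
    convert! h using 3 with i
    omega

theorem of_periodic {s : ℕ → E} {m : ℕ} (hm : 0 < m) (hs : Function.Periodic s m) :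
    CesaroConvergent s := by
  have hm' : (m : ℝ) ≠ 0 := by positivity
  set a : E := (m : ℝ)⁻¹ • ∑ i ∈ Finset.range m, s i with ha
  set T : ℕ → E := fun n => ∑ i ∈ Finset.range n, (s i - a) with hT
  -- Subtracting the mean over one period makes the partial sums periodic, hence bounded.
  have hTper : Function.Periodic T m := fun n => by
    simp only [hT]
    rw [add_comm n m, Finset.sum_range_add]
    have h0 : ∑ i ∈ Finset.range m, (s i - a) = 0 := by
      rw [Finset.sum_sub_distrib, Finset.sum_const, Finset.card_range, ← Nat.cast_smul_eq_nsmul ℝ,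
        ha, smul_smul, mul_inv_cancel₀ hm', one_smul, sub_self]
    rw [h0, zero_add]
    exact Finset.sum_congr rfl fun i _ => by rw [add_comm m i, hs i]
  have hbound (n : ℕ) : ‖T n‖ ≤ ∑ j ∈ Finset.range m, ‖T j‖ := by
    rw [← hTper.map_mod_nat n]
    exact Finset.single_le_sum (f := fun j => ‖T j‖) (fun j _ => norm_nonneg _)
      (Finset.mem_range.2 (Nat.mod_lt n hm))
  have hlim : Tendsto (fun n : ℕ => (n : ℝ)⁻¹ • T n) atTop (𝓝 0) :=
    (tendsto_inv_atTop_nhds_zero_nat (𝕜 := ℝ)).zero_smul_isBoundedUnder_le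
      (isBoundedUnder_of ⟨_, hbound⟩)
  refine ⟨0 + a, (hlim.add_const a).congr' ?_⟩
  filter_upwards [eventually_gt_atTop 0] with n hn
  have hn' : (n : ℝ) ≠ 0 := by positivity
  simp only [hT]
  rw [Finset.sum_sub_distrib, Finset.sum_const, Finset.card_range, ← Nat.cast_smul_eq_nsmul ℝ,
    smul_sub, smul_smul, inv_mul_cancel₀ hn', one_smul, sub_add_cancel]

end CesaroConvergent

/-- An orbit that stays in a finite set is eventually periodic, so it has a Cesàro limit. -/
theorem cesaroConvergent_iterate_of_finite {f : E → E} {x : E} {t : Set E} (ht : t.Finite)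
    (h : ∀ i, f^[i] x ∈ t) : CesaroConvergent fun i => f^[i] x := by
  obtain ⟨i, j, hij, he⟩ := ht.exists_lt_map_eq_of_forall_mem h
  refine CesaroConvergent.of_shift i (CesaroConvergent.of_periodic (m := j - i) (by omega) ?_)
  intro n
  change f^[n + (j - i) + i] x = f^[n + i] x
  rw [show n + (j - i) + i = n + j by omega, Function.iterate_add_apply,
    Function.iterate_add_apply, he]

end Cesaro

/-! ### Scalar orbits at roots of unity. -/

namespace IsPGF

variable {p : PowerSeries ℝ}

/-- Equality in the triangle inequality: with `w` the value at `z`, the numbers `Re (conj w * z ^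
k)` are at most `1` and have weighted mean `1`, so each one with positive weight equals `1`. -/
theorem exists_pow_eq_of_norm_eq_one (hp : IsPGF p) {z : ℂ} (hz : ‖z‖ = 1)
    (h : ‖evalSeries p z‖ = 1) : ∃ k, evalSeries p z = z ^ k := by
  obtain ⟨k, hk⟩ : ∃ k, PowerSeries.coeff k p ≠ 0 := by
    by_contra! hall
    have := hp.hasSum
    simp only [hall] at this
    exact zero_ne_one (hasSum_zero.unique this)
  set w := evalSeries p z with hw
  have hre : HasSum (fun k => PowerSeries.coeff k p * ((starRingEnd ℂ) w * z ^ k).re) 1 := by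
    have h1 := Complex.hasSum_re ((hp.hasSum_evalSeries hz.le).mul_left ((starRingEnd ℂ) w))
    rw [← hw, mul_comm _ w, Complex.mul_conj, Complex.normSq_eq_norm_sq, h, one_pow,
      Complex.ofReal_one, Complex.one_re] at h1
    exact h1.congr_fun fun k => by rw [mul_smul_comm, Complex.smul_re, smul_eq_mul]
  have hle (k : ℕ) : ((starRingEnd ℂ) w * z ^ k).re ≤ 1 := by
    refine (Complex.re_le_norm _).trans ?_
    simp [h, hz]
  have hk1 : ((starRingEnd ℂ) w * z ^ k).re = 1 := by
    by_contra hne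
    have hlt := hasSum_lt (fun k => mul_le_of_le_one_right (hp.nonneg k) (hle k))
      (mul_lt_of_lt_one_right (lt_of_le_of_ne (hp.nonneg k) (Ne.symm hk))
        (lt_of_le_of_ne (hle k) hne)) hre hp.hasSum
    exact lt_irrefl _ hlt
  have hnorm : ‖(starRingEnd ℂ) w * z ^ k‖ = 1 := by simp [h, hz]
  have hone : (starRingEnd ℂ) w * z ^ k = 1 := by
    have him : ((starRingEnd ℂ) w * z ^ k).im = 0 := by
      have := Complex.sq_norm_sub_sq_re ((starRingEnd ℂ) w * z ^ k)
      rw [hnorm, hk1] at this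
      nlinarith
    exact Complex.ext (by simpa using hk1) (by simpa using him)
  refine ⟨k, ?_⟩
  calc w = w * ((starRingEnd ℂ) w * z ^ k) := by rw [hone, mul_one]
    _ = z ^ k := by
      rw [← mul_assoc, Complex.mul_conj, Complex.normSq_eq_norm_sq, h]
      simp

theorem norm_iterate_le (hp : IsPGF p) {z : ℂ} (hz : ‖z‖ ≤ 1) (i : ℕ) :
    ‖(evalSeries p)^[i] z‖ ≤ 1 := by
  rw [← hp.evalSeries_seriesIter hz]
  exact (hp.seriesIter i).norm_evalSeries_le hz

theorem cesaroConvergent_iterate_of_pow_eq_one (hp : IsPGF p) (hX : p ≠ PowerSeries.X) {z : ℂ}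
    {N : ℕ} (hN : 0 < N) (hz : z ^ N = 1) :
    CesaroConvergent fun i => (evalSeries p)^[i] z := by
  have hz1 : ‖z‖ = 1 := Complex.norm_eq_one_of_pow_eq_one hz hN.ne'
  by_cases hall : ∀ i, ‖(evalSeries p)^[i] z‖ = 1
  · refine cesaroConvergent_iterate_of_finite
      (Polynomial.nthRootsFinset N (1 : ℂ)).finite_toSet fun i => ?_
    rw [Finset.mem_coe, Polynomial.mem_nthRootsFinset hN]
    induction i with
    | zero => exact hz
    | succ i ih =>
      have h := hall (i + 1)
      rw [Function.iterate_succ_apply'] at h ⊢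
      obtain ⟨k, hk⟩ := hp.exists_pow_eq_of_norm_eq_one (hall i) h
      rw [hk, pow_right_comm, ih, one_pow]
  · push Not at hall
    obtain ⟨j, hj⟩ := hall
    have hj1 := lt_of_le_of_ne (hp.norm_iterate_le hz1.le j) hj
    obtain ⟨q, hq⟩ := hp.exists_tendsto_coeff_seriesIter hX
    -- From time `j` on the orbit starts inside the open disc, where the powers form a null sequence
    -- and Toeplitz averaging applies.
    refine CesaroConvergent.of_shift j (CesaroConvergent.of_tendsto
      ((tendsto_tsum_coeff_smul hp.seriesIter hq
        (tendsto_pow_atTop_nhds_zero_of_norm_lt_one hj1)).congr fun i => ?_))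
    rw [Function.iterate_add_apply]
    exact hp.evalSeries_seriesIter hj1.le i

end IsPGF

/-! ### Asymptotically periodic sequences. -/

theorem exists_eq_sum_pow_of_periodic {g : ℕ → ℂ} {N : ℕ} (hN : 0 < N)
    (hg : Function.Periodic g N) :
    ∃ (c : ZMod N → ℂ) (z : ZMod N → ℂ), (∀ j, z j ^ N = 1) ∧
      ∃ _ : Fintype (ZMod N), ∀ k, g k = ∑ j, c j * z j ^ k := by
  have : NeZero N := ⟨hN.ne'⟩
  set Φ : ZMod N → ℂ := fun k => g k.val with hΦ
  -- Fourier inversion on `ZMod N`: the roots of unity are the values of the standard character.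
  refine ⟨fun j => (N : ℂ)⁻¹ * ZMod.dft Φ j, fun j => ZMod.stdAddChar j, fun j => ?_,
    inferInstance, fun k => ?_⟩
  · rw [← AddChar.map_nsmul_eq_pow]
    simp
  · have h := ZMod.invDFT_apply (ZMod.dft Φ) (k : ZMod N)
    rw [LinearEquiv.symm_apply_apply] at h
    have e : g k = Φ k := by
      rw [hΦ]
      simp only [ZMod.val_natCast]
      exact (hg.map_mod_nat k).symm
    rw [e, h, Finset.smul_sum]
    refine Finset.sum_congr rfl fun j _ => ?_
    rw [← AddChar.map_nsmul_eq_pow, nsmul_eq_mul, mul_comm (k : ZMod N) j]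
    simp only [smul_eq_mul]
    ring

/-- The limits along residue classes form the periodic sequence; having only finitely many classes
makes the convergence uniform over them. -/
theorem exists_periodic_tendsto_sub {E : Type*} [NormedAddCommGroup E] {f : ℕ → E} {N : ℕ}
    (hN : 0 < N) (hf : ∀ r, ∃ y, Tendsto (fun n => f (N * n + r)) atTop (𝓝 y)) :
    ∃ g : ℕ → E, Function.Periodic g N ∧ Tendsto (fun k => f k - g k) atTop (𝓝 0) := by
  choose g hg using hf
  have hper : Function.Periodic g N := fun r => by
    refine tendsto_nhds_unique (hg (r + N)) (((tendsto_add_atTop_iff_nat 1).2 (hg r)).congr ?_)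
    intro n
    congr 1
    ring
  refine ⟨g, hper, Metric.tendsto_nhds.2 fun ε hε => ?_⟩
  have h : ∀ᶠ n in atTop, ∀ r ∈ Finset.range N, dist (f (N * n + r)) (g r) < ε :=
    (Finset.eventually_all _).2 fun r _ => Metric.tendsto_nhds.1 (hg r) ε hε
  filter_upwards [(Nat.tendsto_div_const_atTop hN.ne').eventually h] with k hk
  have := hk (k % N) (Finset.mem_range.2 (Nat.mod_lt k hN))
  rw [Nat.div_add_mod, hper.map_mod_nat] at this
  rwa [dist_zero_right, ← dist_eq_norm]

theorem IsPGF.cesaroConvergent_tsum {p : PowerSeries ℝ} (hp : IsPGF p)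
    (hX : p ≠ PowerSeries.X) {f : ℕ → ℂ} {N : ℕ} (hN : 0 < N)
    (hf : ∀ r, ∃ y, Tendsto (fun n => f (N * n + r)) atTop (𝓝 y)) :
    CesaroConvergent fun i =>
      ∑' k, PowerSeries.coeff k (GroupAlgebraSimplex.seriesIter p i) • f k := by
  obtain ⟨g, hper, hlim⟩ := exists_periodic_tendsto_sub hN hf
  obtain ⟨c, z, hz, _, hg⟩ := exists_eq_sum_pow_of_periodic hN hper
  obtain ⟨q, hq⟩ := hp.exists_tendsto_coeff_seriesIter hX
  have hz1 (j : ZMod N) : ‖z j‖ ≤ 1 := (Complex.norm_eq_one_of_pow_eq_one (hz j) hN.ne').le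
  have hgsum (i : ℕ) : HasSum
      (fun k => PowerSeries.coeff k (GroupAlgebraSimplex.seriesIter p i) • g k)
      (∑ j, c j * (evalSeries p)^[i] (z j)) := by
    simp only [← hp.evalSeries_seriesIter (hz1 _)]
    refine (hasSum_sum fun j _ =>
      ((hp.seriesIter i).hasSum_evalSeries (hz1 j)).mul_left (c j)).congr_fun fun k => ?_
    rw [hg, Finset.smul_sum]
    exact Finset.sum_congr rfl fun j _ => (mul_smul_comm _ _ _).symm
  have hdsum (i : ℕ) : Summable fun k =>
      PowerSeries.coeff k (GroupAlgebraSimplex.seriesIter p i) • (f k - g k) :=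
    (hp.seriesIter i).summable_smul_of_tendsto hlim
  have e (i : ℕ) : ∑' k, PowerSeries.coeff k (GroupAlgebraSimplex.seriesIter p i) • f k =
      ∑' k, PowerSeries.coeff k (GroupAlgebraSimplex.seriesIter p i) • (f k - g k) +
        ∑ j, c j * (evalSeries p)^[i] (z j) := by
    rw [← (hgsum i).tsum_eq, ← (hdsum i).tsum_add (hgsum i).summable]
    exact tsum_congr fun k => by rw [← smul_add, sub_add_cancel]
  simp only [e]
  exact (CesaroConvergent.of_tendsto (tendsto_tsum_coeff_smul hp.seriesIter hq hlim)).add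
    (CesaroConvergent.finset_sum _ fun j _ =>
      (hp.cesaroConvergent_iterate_of_pow_eq_one hX hN (hz j)).const_mul (c j))

/-! ### Coordinates, compactness of the simplex, and limits of powers. -/

section GroupAlgebra

variable {G : Type*}

theorem isInducing_coeff :
    IsInducing fun (x : MonoidAlgebra ℝ G) (g : G) => x.coeff g := ⟨rfl⟩

theorem isEmbedding_coeff :
    IsEmbedding fun (x : MonoidAlgebra ℝ G) (g : G) => x.coeff g :=
  ⟨isInducing_coeff, fun _ _ h => MonoidAlgebra.ext (Finsupp.ext (congrFun h))⟩

instance : T2Space (MonoidAlgebra ℝ G) := isEmbedding_coeff.t2Space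

theorem continuous_coeff (g : G) : Continuous fun x : MonoidAlgebra ℝ G => x.coeff g :=
  (continuous_apply g).comp isInducing_coeff.continuous

theorem tendsto_iff_coeff {α : Type*} {l : Filter α} {u : α → MonoidAlgebra ℝ G}
    {y : MonoidAlgebra ℝ G} :
    Tendsto u l (𝓝 y) ↔ ∀ g, Tendsto (fun n => (u n).coeff g) l (𝓝 (y.coeff g)) := by
  rw [isInducing_coeff.tendsto_nhds_iff, tendsto_pi_nhds]
  rfl

theorem continuous_iff_coeff {α : Type*} [TopologicalSpace α] {u : α → MonoidAlgebra ℝ G} :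
    Continuous u ↔ ∀ g, Continuous fun n => (u n).coeff g := by
  rw [isInducing_coeff.continuous_iff, continuous_pi_iff]
  rfl

theorem hasSum_iff_coeff {α : Type*} {u : α → MonoidAlgebra ℝ G} {y : MonoidAlgebra ℝ G} :
    HasSum u y ↔ ∀ g, HasSum (fun n => (u n).coeff g) (y.coeff g) := by
  simp only [HasSum, tendsto_iff_coeff, MonoidAlgebra.coeff_sum, Finsupp.finsetSum_apply]

variable [Fintype G]

/-- The element of the group algebra with prescribed coordinates. -/
noncomputable def ofCoords (v : G → ℝ) : MonoidAlgebra ℝ G :=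
  MonoidAlgebra.ofCoeff (Finsupp.equivFunOnFinite.symm v)

theorem isClosedEmbedding_coeff :
    IsClosedEmbedding fun (x : MonoidAlgebra ℝ G) (g : G) => x.coeff g := by
  refine ⟨isEmbedding_coeff, ?_⟩
  rw [Set.range_eq_univ.2 fun v => ⟨ofCoords v, rfl⟩]
  exact isClosed_univ

theorem isCompact_simplex : IsCompact (simplex G) := by
  convert isClosedEmbedding_coeff.isCompact_preimage (isCompact_stdSimplex ℝ G) using 1
  ext x
  exact and_comm

theorem coeff_le_one_of_mem_simplex {x : MonoidAlgebra ℝ G} (hx : x ∈ simplex G) (g : G) :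
    x.coeff g ≤ 1 := by
  rw [← hx.1]
  exact Finset.single_le_sum (f := fun g => x.coeff g) (fun h _ => hx.2 h) (Finset.mem_univ g)

/-- The squared Euclidean norm of the coordinate vector. -/
noncomputable def energy (w : MonoidAlgebra ℝ G) : ℝ := ∑ g, w.coeff g ^ 2

theorem energy_nonneg (w : MonoidAlgebra ℝ G) : 0 ≤ energy w :=
  Finset.sum_nonneg fun _ _ => sq_nonneg _

theorem continuous_energy : Continuous (energy : MonoidAlgebra ℝ G → ℝ) :=
  continuous_finsetSum _ fun g _ => (continuous_coeff g).pow 2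

theorem eq_zero_of_energy_eq_zero {w : MonoidAlgebra ℝ G} (h : energy w = 0) : w = 0 := by
  refine MonoidAlgebra.ext (Finsupp.ext fun g => ?_)
  have := (Finset.sum_eq_zero_iff_of_nonneg fun g _ => sq_nonneg (w.coeff g)).1 h g
    (Finset.mem_univ g)
  exact pow_eq_zero_iff two_ne_zero |>.1 this

variable [Group G]

theorem coeff_mul_eq_sum (x y : MonoidAlgebra ℝ G) (g : G) :
    (x * y).coeff g = ∑ h, x.coeff h * y.coeff (h⁻¹ * g) := by
  rw [MonoidAlgebra.coeff_mul_apply_left, Finsupp.sum_fintype]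
  simp

instance : ContinuousMul (MonoidAlgebra ℝ G) := by
  refine ⟨continuous_iff_coeff.2 fun g => ?_⟩
  simp only [coeff_mul_eq_sum]
  exact continuous_finsetSum _ fun h _ =>
    ((continuous_coeff _).comp continuous_fst).mul ((continuous_coeff _).comp continuous_snd)

theorem one_mem_simplex : (1 : MonoidAlgebra ℝ G) ∈ simplex G := by
  classical
  refine ⟨?_, fun g => ?_⟩
  · simp [MonoidAlgebra.one_def, MonoidAlgebra.coeff_single]
  · rw [MonoidAlgebra.one_def, MonoidAlgebra.coeff_single, Finsupp.single_apply]
    split_ifs <;> norm_num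

theorem mul_mem_simplex {x y : MonoidAlgebra ℝ G} (hx : x ∈ simplex G) (hy : y ∈ simplex G) :
    x * y ∈ simplex G := by
  refine ⟨?_, fun g => ?_⟩
  · simp only [coeff_mul_eq_sum]
    rw [Finset.sum_comm]
    have h (a : G) : ∑ g, x.coeff a * y.coeff (a⁻¹ * g) = x.coeff a := by
      have e := Equiv.sum_comp (Equiv.mulLeft a⁻¹) fun g => y.coeff g
      simp only [Equiv.coe_mulLeft] at e
      rw [← Finset.mul_sum, e, hy.1, mul_one]
    simp only [h, hx.1]
  · rw [coeff_mul_eq_sum]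
    exact Finset.sum_nonneg fun h _ => mul_nonneg (hx.2 _) (hy.2 _)

theorem pow_mem_simplex {x : MonoidAlgebra ℝ G} (hx : x ∈ simplex G) (n : ℕ) :
    x ^ n ∈ simplex G := by
  induction n with
  | zero => simpa using one_mem_simplex
  | succ n ih => rw [pow_succ]; exact mul_mem_simplex ih hx

/-- Each coordinate of `y * w` is the `y`-mean of translates of `w`. The variance is mean square
minus squared mean, and it is bounded below by its term at the identity. Summing over the group, all
translates have the same energy. -/
theorem energy_mul_add_le {y : MonoidAlgebra ℝ G} (hy : y ∈ simplex G) (w : MonoidAlgebra ℝ G) :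
    energy (y * w) + y.coeff 1 * energy (w - y * w) ≤ energy w := by
  have hvar (g : G) : (y * w).coeff g ^ 2 + y.coeff 1 * (w - y * w).coeff g ^ 2 ≤
      ∑ h, y.coeff h * w.coeff (h⁻¹ * g) ^ 2 := by
    set m := (y * w).coeff g with hm
    have h1 : y.coeff 1 * (w.coeff g - m) ^ 2 ≤ ∑ h, y.coeff h * (w.coeff (h⁻¹ * g) - m) ^ 2 := by
      have := Finset.single_le_sum (f := fun h => y.coeff h * (w.coeff (h⁻¹ * g) - m) ^ 2)
        (fun h _ => mul_nonneg (hy.2 h) (sq_nonneg _)) (Finset.mem_univ 1)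
      simpa using this
    have h2 : ∑ h, y.coeff h * (w.coeff (h⁻¹ * g) - m) ^ 2 =
        ∑ h, y.coeff h * w.coeff (h⁻¹ * g) ^ 2 - m ^ 2 := by
      have e : ∀ h, y.coeff h * (w.coeff (h⁻¹ * g) - m) ^ 2 =
          y.coeff h * w.coeff (h⁻¹ * g) ^ 2 - 2 * m * (y.coeff h * w.coeff (h⁻¹ * g)) +
            m ^ 2 * y.coeff h := fun h => by ring
      simp only [e]
      rw [Finset.sum_add_distrib, Finset.sum_sub_distrib, ← Finset.mul_sum, ← Finset.mul_sum,
        hy.1, ← coeff_mul_eq_sum, ← hm]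
      ring
    have h3 : (w - y * w).coeff g = w.coeff g - m := rfl
    rw [h3]
    linarith
  calc energy (y * w) + y.coeff 1 * energy (w - y * w)
      = ∑ g, ((y * w).coeff g ^ 2 + y.coeff 1 * (w - y * w).coeff g ^ 2) := by
        rw [Finset.sum_add_distrib, ← Finset.mul_sum, energy, energy]
    _ ≤ ∑ g, ∑ h, y.coeff h * w.coeff (h⁻¹ * g) ^ 2 := Finset.sum_le_sum fun g _ => hvar g
    _ = ∑ h, y.coeff h * energy w := by
        rw [Finset.sum_comm]
        refine Finset.sum_congr rfl fun h _ => ?_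
        have e := Equiv.sum_comp (Equiv.mulLeft h⁻¹) fun g => w.coeff g ^ 2
        simp only [Equiv.coe_mulLeft] at e
        rw [← Finset.mul_sum, e, energy]
    _ = energy w := by rw [← Finset.sum_mul, hy.1, one_mul]

/-- By compactness it suffices that cluster points agree. The energy of `y ^ n` decreases to a
limit, so a cluster point loses no energy under `y` and is therefore fixed by `y`. Two such points
`u`, `v` satisfy `v * u = u` and `u * v = v`, and they commute as limits of powers of `y`. -/
theorem exists_tendsto_pow_of_coeff_one_pos {y : MonoidAlgebra ℝ G} (hy : y ∈ simplex G)
    (h1 : 0 < y.coeff 1) : ∃ u, Tendsto (fun n => y ^ n) atTop (𝓝 u) := by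
  have hanti : Antitone fun n => energy (y ^ n) := antitone_nat_of_succ_le fun n => by
    rw [pow_succ']
    have := energy_mul_add_le hy (y ^ n)
    linarith [mul_nonneg h1.le (energy_nonneg (y ^ n - y * y ^ n))]
  have hE := tendsto_atTop_ciInf hanti ⟨0, by rintro _ ⟨n, rfl⟩; exact energy_nonneg _⟩
  have hfix {U : Ultrafilter ℕ} (hU : (U : Filter ℕ) ≤ atTop) {u : MonoidAlgebra ℝ G}
      (hu : Tendsto (fun n => y ^ n) U (𝓝 u)) : y * u = u := by
    have e1 := tendsto_nhds_unique ((continuous_energy.tendsto u).comp hu) (hE.mono_left hU)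
    have hyu : Tendsto (fun n => y ^ (n + 1)) U (𝓝 (y * u)) := by
      simpa only [pow_succ'] using hu.const_mul y
    have e2 := tendsto_nhds_unique ((continuous_energy.tendsto _).comp hyu)
      (((tendsto_add_atTop_iff_nat 1).2 hE).mono_left hU)
    have hle := energy_mul_add_le hy u
    rw [e1, e2] at hle
    have h0 : energy (u - y * u) = 0 :=
      le_antisymm (by nlinarith [energy_nonneg (u - y * u)]) (energy_nonneg _)
    exact (sub_eq_zero.1 (eq_zero_of_energy_eq_zero h0)).symm
  have hpowfix {u : MonoidAlgebra ℝ G} (hu : y * u = u) (n : ℕ) : y ^ n * u = u := by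
    induction n with
    | zero => simp
    | succ n ih => rw [pow_succ, mul_assoc, hu, ih]
  have hcomm {U : Ultrafilter ℕ} {u v : MonoidAlgebra ℝ G}
      (hu : Tendsto (fun n => y ^ n) U (𝓝 u)) (hv : y * v = v) : u * v = v := by
    refine tendsto_nhds_unique (hu.mul_const v) ?_
    simp only [hpowfix hv]
    exact tendsto_const_nhds
  have hmem (n : ℕ) : y ^ n ∈ simplex G := pow_mem_simplex hy n
  obtain ⟨u, -, hu⟩ := isCompact_simplex.exists_mapClusterPt (f := atTop) (u := fun n => y ^ n)
    (tendsto_principal.2 (Eventually.of_forall hmem))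
  obtain ⟨U, hU, hUu⟩ := mapClusterPt_iff_ultrafilter.1 hu
  refine ⟨u, isCompact_simplex.tendsto_nhds_of_unique_mapClusterPt (Eventually.of_forall hmem)
    fun v _ hv => ?_⟩
  obtain ⟨V, hV, hVv⟩ := mapClusterPt_iff_ultrafilter.1 hv
  have hvu : v * u = u := hcomm hVv (hfix hU hUu)
  have huv : u * v = v := hcomm hUu (hfix hV hVv)
  have huy : Tendsto (fun n => y ^ n * u) V (𝓝 (v * u)) := hVv.mul_const u
  have hyu (n : ℕ) : y ^ n * u = u * y ^ n := by
    refine tendsto_nhds_unique (hUu.const_mul (y ^ n)) ((hUu.mul_const (y ^ n)).congr fun m => ?_)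
    rw [← pow_add, ← pow_add, add_comm]
  simp only [hyu] at huy
  rw [← hvu, ← tendsto_nhds_unique (hVv.const_mul u) huy, huv]

theorem coeff_pow_card_one_pos {x : MonoidAlgebra ℝ G} (hx : x ∈ simplex G) :
    0 < (x ^ Fintype.card G).coeff 1 := by
  obtain ⟨g, hg⟩ : ∃ g, 0 < x.coeff g := by
    by_contra! h
    have := Finset.sum_nonpos fun g (_ : g ∈ Finset.univ) => h g
    rw [hx.1] at this
    linarith
  -- Taken at `n = |G|`, where `g ^ n = 1`.
  have hpow (n : ℕ) : 0 < (x ^ n).coeff (g ^ n) := by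
    induction n with
    | zero => simp
    | succ n ih =>
      rw [pow_succ, coeff_mul_eq_sum]
      refine (mul_pos ih hg).trans_le ?_
      have := Finset.single_le_sum
        (f := fun h => (x ^ n).coeff h * x.coeff (h⁻¹ * g ^ (n + 1)))
        (fun h _ => mul_nonneg ((pow_mem_simplex hx n).2 h) (hx.2 _)) (Finset.mem_univ (g ^ n))
      simpa [pow_succ] using this
  simpa using hpow (Fintype.card G)

theorem exists_tendsto_pow_mul_add {x : MonoidAlgebra ℝ G} (hx : x ∈ simplex G) (r : ℕ) :
    ∃ y, Tendsto (fun n => x ^ (Fintype.card G * n + r)) atTop (𝓝 y) := by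
  obtain ⟨u, hu⟩ := exists_tendsto_pow_of_coeff_one_pos
    (pow_mem_simplex hx (Fintype.card G)) (coeff_pow_card_one_pos hx)
  refine ⟨u * x ^ r, (hu.mul_const (x ^ r)).congr fun n => ?_⟩
  rw [← pow_mul, pow_add]

theorem IsPGF.hasSum_seriesMap {p : PowerSeries ℝ} (hp : IsPGF p)
    {x : MonoidAlgebra ℝ G} (hx : x ∈ simplex G) : HasSum (seriesTerm p x) (seriesMap p x) := by
  have h (g : G) : Summable fun k => (seriesTerm p x k).coeff g := by
    refine Summable.of_nonneg_of_le (fun k => ?_) (fun k => ?_) hp.hasSum.summable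
    · exact mul_nonneg (hp.nonneg k) ((pow_mem_simplex hx k).2 g)
    · exact mul_le_of_le_one_right (hp.nonneg k)
        (coeff_le_one_of_mem_simplex (pow_mem_simplex hx k) g)
  have hs : HasSum (seriesTerm p x) (ofCoords fun g => ∑' k, (seriesTerm p x k).coeff g) :=
    hasSum_iff_coeff.2 fun g => (h g).hasSum
  exact hs.summable.hasSum

theorem IsPGF.mapsTo_simplex {p : PowerSeries ℝ} (hp : IsPGF p) :
    Set.MapsTo (seriesMap p) (simplex G) (simplex G) := by
  intro x hx
  have h := hasSum_iff_coeff.1 (hp.hasSum_seriesMap hx)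
  refine ⟨?_, fun g => (h g).nonneg fun k =>
    mul_nonneg (hp.nonneg k) ((pow_mem_simplex hx k).2 g)⟩
  refine (hasSum_sum fun g (_ : g ∈ Finset.univ) => h g).unique ?_
  refine hp.hasSum.congr_fun fun k => ?_
  simp only [seriesTerm, MonoidAlgebra.coeff_smul_apply, smul_eq_mul]
  rw [← Finset.mul_sum, (pow_mem_simplex hx k).1, mul_one]

end GroupAlgebra

/-! ### Transfer to a normed algebra by the left regular representation. -/

section LeftRegular

attribute [local instance] Matrix.linftyOpNormedRing Matrix.linftyOpNormedAlgebra

variable {G : Type*} [Group G] [Fintype G] [DecidableEq G]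

/-- The left regular representation of the group algebra by matrices. -/
noncomputable def leftRegular : MonoidAlgebra ℝ G →ₐ[ℝ] Matrix G G ℝ :=
  AlgHom.ofLinearMap
    { toFun := fun x => Matrix.of fun g h => x.coeff (g * h⁻¹)
      map_add' := fun _ _ => rfl
      map_smul' := fun _ _ => rfl }
    (by
      ext g h
      change (1 : MonoidAlgebra ℝ G).coeff (g * h⁻¹) = _
      rw [MonoidAlgebra.one_def, MonoidAlgebra.coeff_single, Finsupp.single_apply, Matrix.one_apply]
      simp only [eq_comm (a := (1 : G)), mul_inv_eq_one])
    (fun x y => by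
      ext g h
      change (x * y).coeff (g * h⁻¹) = ∑ k, x.coeff (g * k⁻¹) * y.coeff (k * h⁻¹)
      rw [coeff_mul_eq_sum]
      refine Fintype.sum_equiv ((Equiv.inv G).trans (Equiv.mulRight g)) _ _ fun k => ?_
      simp [mul_assoc])

theorem leftRegular_apply (x : MonoidAlgebra ℝ G) (g h : G) :
    leftRegular x g h = x.coeff (g * h⁻¹) := rfl

theorem leftRegular_apply_one (x : MonoidAlgebra ℝ G) (g : G) :
    leftRegular x g 1 = x.coeff g := by
  rw [leftRegular_apply, inv_one, mul_one]

theorem continuous_leftRegular : Continuous (leftRegular : MonoidAlgebra ℝ G → Matrix G G ℝ) :=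
  continuous_pi fun _ => continuous_pi fun _ => continuous_coeff _

/-- The matrix of a point of the simplex has nonnegative entries and row sums `1`, so the norm
induced by the sup norm puts it in the unit ball, where the composition identities hold. -/
theorem norm_leftRegular_le_one {x : MonoidAlgebra ℝ G} (hx : x ∈ simplex G) :
    ‖leftRegular x‖ ≤ 1 := by
  rw [Matrix.linfty_opNorm_def, ← NNReal.coe_one, NNReal.coe_le_coe]
  refine Finset.sup_le fun g _ => ?_
  rw [← NNReal.coe_le_coe, NNReal.coe_sum]
  simp only [coe_nnnorm, leftRegular_apply, Real.norm_of_nonneg (hx.2 _)]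
  rw [Fintype.sum_equiv ((Equiv.inv G).trans (Equiv.mulLeft g)) _ (fun k => x.coeff k)
    fun k => by simp, hx.1, NNReal.coe_one]

namespace IsPGF

variable {p : PowerSeries ℝ} {x : MonoidAlgebra ℝ G}

theorem leftRegular_seriesMap (hp : IsPGF p) (hx : x ∈ simplex G) :
    leftRegular (seriesMap p x) = evalSeries p (leftRegular x) := by
  have h := (hp.hasSum_seriesMap hx).map leftRegular continuous_leftRegular
  refine (h.congr_fun fun k => ?_).unique (hp.hasSum_evalSeries (norm_leftRegular_le_one hx))
  simp [seriesTerm]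

theorem leftRegular_iterate_seriesMap (hp : IsPGF p) (hx : x ∈ simplex G) (i : ℕ) :
    leftRegular ((seriesMap p)^[i] x) = (evalSeries p)^[i] (leftRegular x) := by
  induction i with
  | zero => rfl
  | succ i ih =>
    rw [Function.iterate_succ_apply', Function.iterate_succ_apply',
      hp.leftRegular_seriesMap (hp.mapsTo_simplex.iterate i hx), ih]

theorem hasSum_coeff_iterate_seriesMap (hp : IsPGF p) (hx : x ∈ simplex G) (i : ℕ) (g : G) :
    HasSum (fun k => PowerSeries.coeff k (GroupAlgebraSimplex.seriesIter p i) * (x ^ k).coeff g)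
      (((seriesMap p)^[i] x).coeff g) := by
  have hn := norm_leftRegular_le_one hx
  have h := (hp.seriesIter i).hasSum_evalSeries hn
  have e := (hp.evalSeries_seriesIter hn i).trans (hp.leftRegular_iterate_seriesMap hx i).symm
  rw [e] at h
  -- The column at the identity recovers the coordinates.
  have h' := h.map (Matrix.entryLinearMap ℝ ℝ g 1)
    (LinearMap.continuous_of_finiteDimensional _)
  simp only [Matrix.entryLinearMap_apply, leftRegular_apply_one] at h'
  refine h'.congr_fun fun k => ?_
  simp [← map_pow, leftRegular_apply_one]

end IsPGF

end LeftRegular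

/-! ### Convergence of the Cesàro means in the group algebra. -/

section Ergodic

variable {G : Type*}

theorem coeff_cesaroMean (f : MonoidAlgebra ℝ G → MonoidAlgebra ℝ G) (n : ℕ)
    (x : MonoidAlgebra ℝ G) (g : G) :
    (cesaroMean f n x).coeff g = (n : ℝ)⁻¹ * ∑ i ∈ Finset.range n, (f^[i + 1] x).coeff g := by
  rw [cesaroMean, MonoidAlgebra.coeff_smul_apply, MonoidAlgebra.coeff_sum, Finsupp.finsetSum_apply,
    one_div, smul_eq_mul, Finset.range_eq_Ico,
    Finset.sum_Ico_add' (fun i => (f^[i] x).coeff g) 0 n 1]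
  rfl

theorem ErgodicOn.of_eq_id {f : MonoidAlgebra ℝ G → MonoidAlgebra ℝ G} {S : Set (MonoidAlgebra ℝ G)}
    (hf : ∀ x, f x = x) : ErgodicOn f S := by
  intro x hx
  refine ⟨x, hx, tendsto_iff_coeff.2 fun g => tendsto_const_nhds.congr' ?_⟩
  filter_upwards [eventually_gt_atTop 0] with n hn
  have hn' : (n : ℝ) ≠ 0 := by positivity
  simp [coeff_cesaroMean, Function.iterate_fixed (hf x), hn']

theorem cesaroMean_mem_simplex [Fintype G] {f : MonoidAlgebra ℝ G → MonoidAlgebra ℝ G}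
    (hf : Set.MapsTo f (simplex G) (simplex G)) {x : MonoidAlgebra ℝ G} (hx : x ∈ simplex G)
    {n : ℕ} (hn : 0 < n) : cesaroMean f n x ∈ simplex G := by
  have hn' : (n : ℝ) ≠ 0 := by positivity
  refine ⟨?_, fun g => ?_⟩
  · simp only [coeff_cesaroMean]
    rw [← Finset.mul_sum, Finset.sum_comm,
      Finset.sum_congr rfl fun i _ => (hf.iterate (i + 1) hx).1]
    simp [hn']
  · rw [coeff_cesaroMean]
    exact mul_nonneg (by positivity)
      (Finset.sum_nonneg fun i _ => (hf.iterate (i + 1) hx).2 g)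

variable [Group G]

theorem seriesMap_X (x : MonoidAlgebra ℝ G) : seriesMap PowerSeries.X x = x := by
  rw [seriesMap, tsum_eq_single 1]
  · simp [seriesTerm]
  · intro k hk
    simp [seriesTerm, PowerSeries.coeff_X, hk]

variable [Fintype G]

theorem IsPGF.exists_tendsto_coeff_cesaroMean {p : PowerSeries ℝ} (hp : IsPGF p)
    (hX : p ≠ PowerSeries.X) {x : MonoidAlgebra ℝ G} (hx : x ∈ simplex G) (g : G) :
    ∃ c : ℝ, Tendsto (fun n => (cesaroMean (seriesMap p) n x).coeff g) atTop (𝓝 c) := by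
  classical
  have hlim (r : ℕ) : ∃ y : ℂ,
      Tendsto (fun n => (((x ^ (Fintype.card G * n + r)).coeff g : ℝ) : ℂ)) atTop (𝓝 y) := by
    obtain ⟨y, hy⟩ := exists_tendsto_pow_mul_add hx r
    exact ⟨_, (Complex.continuous_ofReal.tendsto _).comp (tendsto_iff_coeff.1 hy g)⟩
  -- The shift is needed because the means start at the first iterate, not at `x` itself.
  obtain ⟨c, hc⟩ := (hp.cesaroConvergent_tsum hX (f := fun k => (((x ^ k).coeff g : ℝ) : ℂ))
    Fintype.card_pos hlim).shift_one
  have e (i : ℕ) : ∑' k, PowerSeries.coeff k (GroupAlgebraSimplex.seriesIter p i) •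
      (((x ^ k).coeff g : ℝ) : ℂ) = ((((seriesMap p)^[i] x).coeff g : ℝ) : ℂ) := by
    rw [← (hp.hasSum_coeff_iterate_seriesMap hx i g).tsum_eq, Complex.ofReal_tsum]
    exact tsum_congr fun k => by rw [Complex.real_smul, Complex.ofReal_mul]
  refine ⟨c.re, ((Complex.continuous_re.tendsto c).comp hc).congr fun n => ?_⟩
  simp only [Function.comp_apply, e]
  rw [coeff_cesaroMean, Complex.smul_re, smul_eq_mul, ← Complex.ofReal_sum, Complex.ofReal_re]

theorem IsPGF.ergodicOn_simplex {p : PowerSeries ℝ} (hp : IsPGF p) :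
    ErgodicOn (seriesMap p) (simplex G) := by
  -- The iterates of `X` are all `X`, so the weights do not tend to those of a constant; here the
  -- map is the identity.
  by_cases hX : p = PowerSeries.X
  · subst hX
    exact ErgodicOn.of_eq_id seriesMap_X
  intro x hx
  classical
  choose c hc using fun g => hp.exists_tendsto_coeff_cesaroMean hX hx g
  have hlim : Tendsto (fun n => cesaroMean (seriesMap p) n x) atTop (𝓝 (ofCoords c)) :=
    tendsto_iff_coeff.2 hc
  refine ⟨ofCoords c, isCompact_simplex.isClosed.mem_of_tendsto hlim ?_, hlim⟩
  -- The mean at `n = 0` is `0`, which lies outside the simplex.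
  filter_upwards [eventually_gt_atTop 0] with n hn
  exact cesaroMean_mem_simplex hp.mapsTo_simplex hx hn

end Ergodic

end GroupAlgebraSimplex

theorem theorem5 {G : Type*} [Group G] [Fintype G] (p : PowerSeries ℝ)
    (hp_nonneg : ∀ k : ℕ, 0 ≤ PowerSeries.coeff k p)
    (hp_sum : HasSum (fun k : ℕ => PowerSeries.coeff k p) 1) :
    (∀ x ∈ GroupAlgebraSimplex.simplex G,
      Summable (GroupAlgebraSimplex.seriesTerm p x)) ∧
    Set.MapsTo (GroupAlgebraSimplex.seriesMap p)
      (GroupAlgebraSimplex.simplex G) (GroupAlgebraSimplex.simplex G) ∧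
    GroupAlgebraSimplex.ErgodicOn (GroupAlgebraSimplex.seriesMap p)
      (GroupAlgebraSimplex.simplex G) := by
  have hp : GroupAlgebraSimplex.IsPGF p := ⟨hp_nonneg, hp_sum⟩
  exact ⟨fun x hx => (hp.hasSum_seriesMap hx).summable, hp.mapsTo_simplex, hp.ergodicOn_simplex⟩
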